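/- Let $\Gamma$ be a discrete abelian group with compact dual group $G$ (the group of all homomorphisms from $\Gamma$ to the circle group $\mathbb T$, with $\gamma(x)$ denoting the value of $x\in G$ at $\gamma\in\Gamma$). A set $E\subseteq\Gamma$ is called $I_0$ if for every bounded function $\phi:E\to\mathbb C$ there is a discrete measure $\mu$ on $G$ (that is, $\mu=\sum_x c(x)\delta_x$ with $\sum_x|c(x)|<\infty$) such that $\widehat\mu(\gamma)=\phi(\gamma)$ for all $\gamma\in E$, where $\widehat\mu(\gamma)=\int_G\overline{\gamma(x)}\,d\mu(x)$. The set $E$ is called weak $\varepsilon$-Kronecker if for every $\phi:E\to\mathbb T$ there is $x\in G$ with $|\phi(\gamma)-\gamma(x)|\le\varepsilon$ for all $\gamma\in E$. For $F\subseteq\Gamma$ and a real number $\varepsilon$, let $P(F,\varepsilon)$ denote the assertion that there are countable disjoint sets $E\subseteq F$ and $E'\subseteq F+F-F$ such that $E$ and $E'$ are both $I_0$ and both weak $\varepsilon$-Kronecker, but $E\cup E'$ is not $I_0$. Theorem. Let $F$ be any infinite subset of a discrete abelian group $\Gamma$. 1. There is some $\varepsilon\le\sqrt2$ for which $P(F,\varepsilon)$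 holds. 2. Let $\iota:\Gamma\to\bigoplus_{\alpha\in\mathcal I}\Omega_\alpha$ be an injective homomorphism, where each $\Omega_\alpha$ is isomorphic either to $\mathbb Q$ or, for some prime $p$, to the group $C(p^\infty)$ of all $p^n$-th roots of unity ($n\ge0$), and let $\pi_\alpha$ be the composition of $\iota$ with the projection onto $\Omega_\alpha$. (a) If $\pi_\alpha(F)$ is infinite for some $\alpha$, then $P(F,\varepsilon)$ holds for every $\varepsilon>0$. (b) If $q\ge2$ is an integer and there are infinitely many $\alpha$ for which some $\lambda\in F$ has $\pi_\alpha(\lambda)$ of order at least $q$ (possibly infinite), then $P(F,\varepsilon_q)$ holds with $\varepsilon_q=|e^{i\pi/q}-1|$. 3. If $\Gamma$ is torsion free, then $P(F,\varepsilon)$ holds for every $\varepsilon>0$. -/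

import Mathlib

open scoped Pointwise ComplexConjugate DirectSum

namespace InterpolationSets

/-- The compact dual group `G` of the discrete abelian group `Γ`. As `Γ` is discrete, all
homomorphisms from `Γ` to the circle are continuous. The value `γ(x)` is written `x γ`. -/
abbrev Dual (Γ : Type*) [AddCommGroup Γ] : Type _ := AddChar Γ Circle

/-- A (finite, complex) discrete measure `∑ₓ c(x) δₓ` with `∑ₓ |c(x)| < ∞`, given by its
point masses; summability forces `c` to vanish off a countable set. -/
structure DiscreteMeasure (X : Type*) where
  mass : X → ℂ
  summable_norm : Summable fun x => ‖mass x‖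

/-- The Fourier transform `γ ↦ ∫ conj γ(x) dμ(x)` of a discrete measure on the dual group. -/
noncomputable def DiscreteMeasure.fourier {Γ : Type*} [AddCommGroup Γ]
    (μ : DiscreteMeasure (Dual Γ)) (γ : Γ) : ℂ :=
  ∑' x : Dual Γ, conj (x γ : ℂ) * μ.mass x

/-- `E` is an `I₀` set: every bounded function on `E` is interpolated by the Fourier transform
of a discrete measure on the dual group. -/
def IsI0 {Γ : Type*} [AddCommGroup Γ] (E : Set Γ) : Prop :=
  ∀ φ : E → ℂ, (∃ C : ℝ, ∀ γ, ‖φ γ‖ ≤ C) →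
    ∃ μ : DiscreteMeasure (Dual Γ), ∀ γ : E, μ.fourier (γ : Γ) = φ γ

/-- `E` is weak `ε`-Kronecker: every circle-valued function on `E` is within `ε`, uniformly
on `E`, of evaluation at some point of the dual group. -/
def IsWeakKronecker {Γ : Type*} [AddCommGroup Γ] (ε : ℝ) (E : Set Γ) : Prop :=
  ∀ φ : E → Circle, ∃ x : Dual Γ, ∀ γ : E, ‖(φ γ : ℂ) - (x (γ : Γ) : ℂ)‖ ≤ ε

/-- The pair `E, E'` consists of countable disjoint sets `E ⊆ F`, `E' ⊆ F + F - F` that are both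
`I₀` and weak `ε`-Kronecker, while their union is not `I₀`. -/
structure IsGoodPair {Γ : Type*} [AddCommGroup Γ] (F : Set Γ) (ε : ℝ) (E E' : Set Γ) : Prop where
  countable_left : E.Countable
  countable_right : E'.Countable
  disjoint : Disjoint E E'
  subset_left : E ⊆ F
  subset_right : E' ⊆ F + F - F
  isI0_left : IsI0 E
  isI0_right : IsI0 E'
  not_isI0_union : ¬ IsI0 (E ∪ E')
  kronecker_left : IsWeakKronecker ε E
  kronecker_right : IsWeakKronecker ε E'

/-- The multiplicative group of all `p ^ n`-th roots of unity, `n = 0, 1, 2, …`. -/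
def primePowerRoots (p : ℕ) : Subgroup Circle where
  carrier := {z | ∃ n : ℕ, z ^ p ^ n = 1}
  one_mem' := ⟨0, one_pow _⟩
  mul_mem' := by
    rintro a b ⟨m, hm⟩ ⟨n, hn⟩
    refine ⟨m + n, ?_⟩
    rw [mul_pow, pow_add, pow_mul, hm, one_pow, one_mul, mul_comm, pow_mul, hn, one_pow]
  inv_mem' := by
    rintro a ⟨n, hn⟩
    exact ⟨n, by rw [inv_pow, hn, inv_one]⟩

/-- `A` is (isomorphic to) `ℚ` or a group `C(p^∞)` with `p` prime, the latter written
additively. -/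
def IsRatOrPrufer (A : Type*) [AddCommGroup A] : Prop :=
  Nonempty (A ≃+ ℚ) ∨ ∃ p : ℕ, p.Prime ∧ Nonempty (A ≃+ Additive (primePowerRoots p))

/-- The order of `a` is at least `q`; this includes elements of infinite order, for which
`addOrderOf a = 0`. -/
def OrderAtLeast {A : Type*} [AddCommGroup A] (q : ℕ) (a : A) : Prop :=
  addOrderOf a = 0 ∨ q ≤ addOrderOf a

end InterpolationSets

open InterpolationSets

namespace InterpolationSets

/-! ### Extension of homomorphisms into divisible groups -/

theorem baer_circle : Module.Baer ℤ (Additive Circle) := by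
  have h : ∀ {n : ℤ}, n ≠ 0 →
      Function.Surjective (fun a : Additive Circle => n • a) := by
    intro n hn a
    refine ⟨Additive.ofMul (Circle.exp ((a.toMul : ℂ).arg / n)), ?_⟩
    apply Additive.toMul.injective
    simp only [toMul_zsmul, toMul_ofMul]
    rw [← Circle.exp_zsmul, zsmul_eq_mul, mul_div_cancel₀ _ (by exact_mod_cast hn), Circle.exp_arg]
  let _ : DivisibleBy (Additive Circle) ℤ := divisibleByOfSMulRightSurj _ _ h
  exact Module.Baer.of_divisible _

theorem exists_hom_comp_eq {Q M N : Type*} [AddCommGroup Q] [AddCommGroup M] [AddCommGroup N]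
    (hQ : Module.Baer ℤ Q) (f : M →+ N) (g : M →+ Q) (h : f.ker ≤ g.ker) :
    ∃ k : N →+ Q, k.comp f = g := by
  obtain ⟨k, hk⟩ := hQ.extension_property_addMonoidHom (QuotientAddGroup.kerLift f)
    (QuotientAddGroup.kerLift_injective f) (QuotientAddGroup.lift f.ker g h)
  refine ⟨k, AddMonoidHom.ext fun m => ?_⟩
  have := DFunLike.congr_fun hk (m : M ⧸ f.ker)
  simpa using this

/-! ### Characters with prescribed approximate values -/

theorem norm_exp_sub_exp (a b : ℝ) :
    ‖(Circle.exp a : ℂ) - Circle.exp b‖ = 2 * |Real.sin ((a - b) / 2)| := by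
  have h : (Circle.exp a : ℂ) - Circle.exp b =
      Circle.exp b * (Complex.exp (Complex.I * ((a - b : ℝ) : ℂ)) - 1) := by
    rw [Circle.coe_exp, Circle.coe_exp, mul_sub, ← Complex.exp_add, mul_one]
    congr 2
    push_cast
    ring
  rw [h, norm_mul, Circle.norm_coe, one_mul, Complex.norm_exp_I_mul_ofReal_sub_one, norm_mul]
  simp

/-- The largest distance from a point of the circle to the set of `q`-th roots of unity. -/
noncomputable def rootGap (q : ℕ) : ℝ := ‖Complex.exp (Complex.I * Real.pi / q) - 1‖

theorem rootGap_nonneg (q : ℕ) : 0 ≤ rootGap q := norm_nonneg _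

theorem rootGap_eq {q : ℕ} (hq : 1 ≤ q) : rootGap q = 2 * Real.sin (Real.pi / q / 2) := by
  have h : Complex.I * Real.pi / q = Complex.I * ((Real.pi / q : ℝ) : ℂ) := by
    push_cast; ring
  rw [rootGap, h, Complex.norm_exp_I_mul_ofReal_sub_one, norm_mul, Real.norm_eq_abs,
    Real.norm_eq_abs, abs_two, abs_of_nonneg]
  have hq' : (1 : ℝ) ≤ q := by exact_mod_cast hq
  apply Real.sin_nonneg_of_nonneg_of_le_pi (by positivity)
  have : Real.pi / q ≤ Real.pi := div_le_self Real.pi_pos.le hq'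
  linarith [Real.pi_pos]

theorem rootGap_le {q : ℕ} (hq : 1 ≤ q) : rootGap q ≤ Real.pi / q := by
  rw [rootGap_eq hq]
  have : Real.sin (Real.pi / q / 2) ≤ Real.pi / q / 2 := Real.sin_le (by positivity)
  linarith

theorem rootGap_le_one {q : ℕ} (hq : 3 ≤ q) : rootGap q ≤ 1 := by
  rw [rootGap_eq (by omega)]
  have hq' : (3 : ℝ) ≤ q := by exact_mod_cast hq
  have h6 : Real.pi / q / 2 ≤ Real.pi / 6 := by
    rw [div_div]
    exact div_le_div_of_nonneg_left Real.pi_pos.le (by norm_num) (by linarith)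
  have h0 : 0 ≤ Real.pi / q / 2 := by positivity
  have := Real.sin_le_sin_of_le_of_le_pi_div_two (by linarith [Real.pi_pos])
    (by linarith [Real.pi_pos]) h6
  rw [Real.sin_pi_div_six] at this
  linarith

theorem rootGap_two : rootGap 2 = √2 := by
  rw [rootGap_eq (by norm_num)]
  have : Real.pi / (2 : ℕ) / 2 = Real.pi / 4 := by push_cast; ring
  rw [this, Real.sin_pi_div_four]
  ring

theorem norm_exp_sub_exp_le_rootGap {q : ℕ} (hq : 1 ≤ q) {a b : ℝ}
    (h : |a - b| ≤ Real.pi / q) :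
    ‖(Circle.exp a : ℂ) - Circle.exp b‖ ≤ rootGap q := by
  rw [norm_exp_sub_exp, rootGap_eq hq]
  have hq' : (1 : ℝ) ≤ q := by exact_mod_cast hq
  have hp : Real.pi / q ≤ Real.pi := div_le_self Real.pi_pos.le hq'
  have h' := abs_le.1 h
  have : |Real.sin ((a - b) / 2)| ≤ Real.sin (Real.pi / q / 2) := by
    rw [abs_le, ← Real.sin_neg]
    constructor <;> apply Real.sin_le_sin_of_le_of_le_pi_div_two <;> linarith
  linarith

theorem exists_root_near {N q : ℕ} (hq : 1 ≤ q) (hN : N = 0 ∨ q ≤ N) (w : Circle) :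
    ∃ v : Circle, v ^ N = 1 ∧ ‖(v : ℂ) - w‖ ≤ rootGap q := by
  rcases hN with rfl | hN
  · exact ⟨w, pow_zero _, by simpa using rootGap_nonneg q⟩
  have hN0 : (0 : ℝ) < N := by exact_mod_cast (by omega : 0 < N)
  have hq0 : (0 : ℝ) < q := by exact_mod_cast hq
  set θ := (w : ℂ).arg
  set k : ℤ := round (θ * N / (2 * Real.pi))
  refine ⟨Circle.exp (2 * Real.pi * k / N), ?_, ?_⟩
  · rw [← Circle.exp_nsmul, nsmul_eq_mul, mul_div_cancel₀ _ hN0.ne', mul_comm]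
    exact Circle.exp_int_mul_two_pi k
  · rw [← Circle.exp_arg w]
    apply norm_exp_sub_exp_le_rootGap hq
    have h := abs_sub_round (θ * N / (2 * Real.pi))
    have e : 2 * Real.pi * k / N - θ =
        -((2 * Real.pi / N) * (θ * N / (2 * Real.pi) - k)) := by
      field_simp; ring
    change |2 * Real.pi * k / N - θ| ≤ _
    rw [e, abs_neg, abs_mul, abs_of_pos (by positivity)]
    calc 2 * Real.pi / N * |θ * N / (2 * Real.pi) - k| ≤ 2 * Real.pi / N * (1 / 2) := by gcongr
      _ = Real.pi / N := by ring
      _ ≤ Real.pi / q := by gcongr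

theorem exists_dual_near {A : Type*} [AddCommGroup A] {q : ℕ} (hq : 1 ≤ q) (a : A)
    (ha : OrderAtLeast q a) (w : Circle) :
    ∃ x : Dual A, ‖(x a : ℂ) - w‖ ≤ rootGap q := by
  obtain ⟨v, hv, hvw⟩ := exists_root_near hq ha w
  obtain ⟨k, hk⟩ := exists_hom_comp_eq baer_circle (zmultiplesHom A a)
    (zmultiplesHom (Additive Circle) (Additive.ofMul v)) (by
      intro n hn
      rw [AddMonoidHom.mem_ker, zmultiplesHom_apply] at hn ⊢
      obtain ⟨m, rfl⟩ := addOrderOf_dvd_iff_zsmul_eq_zero.2 hn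
      rw [mul_comm, mul_zsmul, natCast_zsmul, ← ofMul_pow, hv, ofMul_one, zsmul_zero])
  refine ⟨AddChar.toAddMonoidHomEquiv.symm k, ?_⟩
  have : k a = Additive.ofMul v := by
    have := DFunLike.congr_fun hk 1
    simpa using this
  simpa [this] using hvw

theorem exists_dual_near_of_subgroup {Γ : Type*} [AddCommGroup Γ] {q : ℕ} (hq : 1 ≤ q)
    (H : AddSubgroup Γ) {u : Γ} (hu : ∀ m : ℕ, 0 < m → m < q → m • u ∉ H)
    (x : Dual Γ) (w : Circle) :
    ∃ y : Dual Γ, ‖(y u : ℂ) - w‖ ≤ rootGap q ∧ ∀ γ ∈ H, y γ = x γ := by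
  have ho : OrderAtLeast q (u : Γ ⧸ H) := by
    rw [OrderAtLeast, or_iff_not_imp_left]
    intro h0
    by_contra! hlt
    refine hu _ (Nat.pos_of_ne_zero h0) hlt ?_
    rw [← QuotientAddGroup.eq_zero_iff]
    exact addOrderOf_nsmul_eq_zero (u : Γ ⧸ H)
  obtain ⟨z, hz⟩ := exists_dual_near hq _ ho (w * (x u)⁻¹)
  refine ⟨x * z.compAddMonoidHom (QuotientAddGroup.mk' H), ?_, fun γ hγ => ?_⟩
  · have : ((x u : ℂ) * z (u : Γ ⧸ H) - w) = x u * (z (u : Γ ⧸ H) - (w * (x u)⁻¹ : Circle)) := by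
      rw [mul_sub, ← Circle.coe_mul, ← Circle.coe_mul, mul_comm w, mul_inv_cancel_left]
    change ‖(x u : ℂ) * z (u : Γ ⧸ H) - w‖ ≤ _
    rwa [this, norm_mul, Circle.norm_coe, one_mul]
  · have : (γ : Γ ⧸ H) = 0 := (QuotientAddGroup.eq_zero_iff γ).2 hγ
    simp [this]

/-! ### Infinite subsets of finitely generated groups -/

/-- `g` is unbounded on `F`. -/
def UnboundedOn {Γ : Type*} (g : Γ → ℝ) (F : Set Γ) : Prop := ∀ B : ℝ, ∃ γ ∈ F, B < |g γ|

theorem exists_hom_unbounded_of_fg {A : Type*} [AddCommGroup A] [AddGroup.FG A] {X : Set A}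
    (hX : X.Infinite) : ∃ h : A →+ ℝ, UnboundedOn h X := by
  obtain ⟨n, ι, _, p, hp, e, ⟨f⟩⟩ := AddCommGroup.equiv_free_prod_directSum_zmod A
  by_contra! hcon
  have hb : ∀ i : Fin n, ∃ B : ℕ, ∀ a ∈ X, |(f a).1 i| ≤ B := by
    intro i
    let c : A →+ ℝ := (Int.castAddHom ℝ).comp ((Finsupp.applyAddHom i).comp
      ((AddMonoidHom.fst _ _).comp f.toAddMonoidHom))
    have := hcon c
    simp only [UnboundedOn, not_forall, not_exists, not_and, not_lt] at this
    obtain ⟨B, hB⟩ := this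
    refine ⟨⌈B⌉₊, fun a ha => ?_⟩
    have h1 : |(((f a).1 i : ℤ) : ℝ)| ≤ B := hB a ha
    have h2 := h1.trans (Nat.le_ceil B)
    exact_mod_cast h2
  choose B hB using hb
  have : ∀ i, NeZero (p i ^ e i) := fun i => ⟨pow_ne_zero _ (hp i).ne_zero⟩
  have : Finite (⨁ i : ι, ZMod (p i ^ e i)) :=
    Finite.of_injective (fun x i => x i) DFunLike.coe_injective
  have hfin : (Set.pi Set.univ (fun i : Fin n => Set.Icc (-(B i : ℤ)) (B i)) ×ˢ
      (Set.univ : Set (⨁ i : ι, ZMod (p i ^ e i)))).Finite :=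
    (Set.Finite.pi fun i => Set.finite_Icc _ _).prod Set.finite_univ
  refine hX (Set.Finite.of_finite_image (f := fun a => ((fun i => (f a).1 i), (f a).2))
    (hfin.subset ?_) ?_)
  · rintro _ ⟨a, ha, rfl⟩
    exact ⟨fun i _ => abs_le.1 (hB i a ha), trivial⟩
  · intro a _ b _ hab
    simp only [Prod.mk.injEq] at hab
    exact f.injective (Prod.ext (DFunLike.coe_injective hab.1) hab.2)

theorem exists_hom_unbounded {Γ : Type*} [AddCommGroup Γ] (s : Finset Γ) {X : Set Γ}
    (hs : X ⊆ AddSubgroup.closure (s : Set Γ)) (hX : X.Infinite) :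
    ∃ h : Γ →+ ℝ, UnboundedOn h X := by
  set H := AddSubgroup.closure (s : Set Γ)
  have : AddGroup.FG H := (AddGroup.fg_iff_addSubgroup_fg H).2 ⟨s, rfl⟩
  have hX' : ((↑) ⁻¹' X : Set H).Infinite := by
    refine hX.preimage ?_
    simpa using hs
  obtain ⟨h, hh⟩ := exists_hom_unbounded_of_fg hX'
  let _ : DivisibleBy ℝ ℤ := divisibleByOfSMulRightSurj _ _ fun {n} hn a =>
    ⟨a / n, by simp [mul_div_cancel₀ a (Int.cast_ne_zero.2 hn : (n : ℝ) ≠ 0)]⟩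
  obtain ⟨k, hk⟩ := (Module.Baer.of_divisible ℝ).extension_property_addMonoidHom H.subtype
    H.subtype_injective h
  refine ⟨k, fun B => ?_⟩
  obtain ⟨a, ha, hB⟩ := hh B
  refine ⟨a, ha, ?_⟩
  rwa [← hk] at hB

variable {Γ : Type*} [AddCommGroup Γ]

/-! ### Weak Kronecker families -/

theorem exists_dual_of_forall_finite (S : Set Γ) (u : ℕ → Γ) (φ : ℕ → Circle) (ε : ℝ)
    (h : ∀ N, ∃ x : Dual Γ, (∀ γ ∈ S, x γ = 1) ∧ ∀ i < N, ‖(x (u i) : ℂ) - φ i‖ ≤ ε) :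
    ∃ x : Dual Γ, (∀ γ ∈ S, x γ = 1) ∧ ∀ i, ‖(x (u i) : ℂ) - φ i‖ ≤ ε := by
  let K : Set (Γ → Circle) := {f | f 0 = 1} ∩ {f | ∀ a b, f (a + b) = f a * f b} ∩
    {f | ∀ γ ∈ S, f γ = 1}
  let t : ℕ → Set (Γ → Circle) := fun N => K ∩ {f | ∀ i < N, ‖(f (u i) : ℂ) - φ i‖ ≤ ε}
  have hK : IsClosed K := by
    refine (IsClosed.inter ?_ ?_).inter ?_
    · exact isClosed_eq (continuous_apply 0) continuous_const
    · simp only [Set.ofPred_forall]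
      exact isClosed_iInter fun a => isClosed_iInter fun b =>
        isClosed_eq (continuous_apply _) ((continuous_apply a).mul (continuous_apply b))
    · simp only [Set.ofPred_forall]
      exact isClosed_iInter fun γ => isClosed_iInter fun _ =>
        isClosed_eq (continuous_apply γ) continuous_const
  have ht : ∀ N, IsClosed (t N) := by
    intro N
    refine hK.inter ?_
    simp only [Set.ofPred_forall]
    exact isClosed_iInter fun i => isClosed_iInter fun _ =>
      isClosed_le (((continuous_subtype_val.comp (continuous_apply (u i))).sub
        continuous_const).norm) continuous_const
  obtain ⟨f, hf⟩ := IsCompact.nonempty_iInter_of_sequence_nonempty_isCompact_isClosed t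
    (fun N f hf => ⟨hf.1, fun i hi => hf.2 i (by omega)⟩)
    (fun N => by
      obtain ⟨x, hx, hx'⟩ := h N
      exact ⟨x, ⟨⟨x.map_zero_eq_one, x.map_add_eq_mul⟩, hx⟩, hx'⟩)
    (ht 0).isCompact ht
  rw [Set.mem_iInter] at hf
  exact ⟨⟨f, (hf 0).1.1.1, (hf 0).1.1.2⟩, (hf 0).1.2, fun i => (hf (i + 1)).2 i (by omega)⟩

/-- If characters can be corrected one term of the sequence at a time, with little change at the
earlier terms, then all terms can be interpolated approximately. -/
theorem exists_dual_of_step (S : Set Γ) (u : ℕ → Γ) {ε η : ℝ} (hη : 0 ≤ η)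
    (h : ∀ n (x : Dual Γ) (w : Circle), ∃ y : Dual Γ, ‖(y (u n) : ℂ) - w‖ ≤ ε ∧
      (∀ γ ∈ S, y γ = x γ) ∧ ∀ i < n, ‖(y (u i) : ℂ) - x (u i)‖ ≤ η * (1 / 2) ^ (n + 1))
    (φ : ℕ → Circle) :
    ∃ x : Dual Γ, (∀ γ ∈ S, x γ = 1) ∧ ∀ i, ‖(x (u i) : ℂ) - φ i‖ ≤ ε + η := by
  have key : ∀ N, ∃ x : Dual Γ, (∀ γ ∈ S, x γ = 1) ∧
      ∀ i < N, ‖(x (u i) : ℂ) - φ i‖ ≤ ε + η * (1 - (1 / 2) ^ N) := by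
    intro N
    induction N with
    | zero => exact ⟨1, fun γ _ => by simp, fun i hi => by omega⟩
    | succ N ih =>
      obtain ⟨x, hx, hx'⟩ := ih
      obtain ⟨y, hy, hyS, hy'⟩ := h N x (φ N)
      refine ⟨y, fun γ hγ => by rw [hyS γ hγ, hx γ hγ], fun i hi => ?_⟩
      rcases Nat.lt_succ_iff_lt_or_eq.1 hi with hi | rfl
      · have h1 := norm_sub_le_norm_sub_add_norm_sub (y (u i) : ℂ) (x (u i)) (φ i)
        have h2 := hx' i hi
        have h3 := hy' i hi
        have e : (1 / 2 : ℝ) ^ N = 2 * (1 / 2) ^ (N + 1) := by ring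
        rw [e] at h2
        linarith
      · have : (1 / 2 : ℝ) ^ (i + 1) ≤ 1 := pow_le_one₀ (by norm_num) (by norm_num)
        have := mul_nonneg hη (sub_nonneg.2 this)
        linarith
  refine exists_dual_of_forall_finite S u φ _ fun N => ?_
  obtain ⟨x, hx, hx'⟩ := key N
  refine ⟨x, hx, fun i hi => (hx' i hi).trans ?_⟩
  have : (0 : ℝ) ≤ (1 / 2) ^ N := by positivity
  have := mul_nonneg hη this
  linarith

theorem isWeakKronecker_range {u : ℕ → Γ} {ε : ℝ}
    (h : ∀ φ : ℕ → Circle, ∃ x : Dual Γ, ∀ i, ‖(x (u i) : ℂ) - φ i‖ ≤ ε) :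
    IsWeakKronecker ε (Set.range u) := by
  intro φ
  obtain ⟨x, hx⟩ := h fun i => φ ⟨u i, i, rfl⟩
  refine ⟨x, ?_⟩
  rintro ⟨_, i, rfl⟩
  rw [norm_sub_rev]
  exact hx i

/-! ### Interpolation by discrete measures -/

theorem exists_discreteMeasure_fourier_eq_tsum (a : ℕ → ℂ) (ha : Summable fun k => ‖a k‖)
    (x : ℕ → Dual Γ) :
    ∃ μ : DiscreteMeasure (Dual Γ), ∀ γ, μ.fourier γ = ∑' k, a k * (x k γ : ℂ) := by
  have hfib : ∀ c : Dual Γ, Summable fun k : (fun k => (x k)⁻¹) ⁻¹' {c} => ‖a k‖ :=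
    fun c => ha.subtype _
  refine ⟨⟨fun c => ∑' k : (fun k => (x k)⁻¹) ⁻¹' {c}, a k, ?_⟩, fun γ => ?_⟩
  · exact Summable.of_nonneg_of_le (fun _ => norm_nonneg _)
      (fun c => norm_tsum_le_tsum_norm (hfib c))
      (ha.hasSum.tsum_fiberwise (fun k => (x k)⁻¹)).summable
  · have hs : Summable fun k => a k * (x k γ : ℂ) :=
      Summable.of_norm (by simpa [norm_mul, Circle.norm_coe] using ha)
    rw [← (hs.hasSum.tsum_fiberwise fun k => (x k)⁻¹).tsum_eq, DiscreteMeasure.fourier]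
    refine tsum_congr fun c => ?_
    rw [← tsum_mul_left]
    refine tsum_congr ?_
    rintro ⟨k, rfl⟩
    rw [mul_comm, ← Circle.coe_inv_eq_conj, AddChar.inv_apply', inv_inv]

theorem DiscreteMeasure.summable_fourier (μ : DiscreteMeasure (Dual Γ)) (γ : Γ) :
    Summable fun x : Dual Γ => conj (x γ : ℂ) * μ.mass x :=
  Summable.of_norm (by simpa [norm_mul, Circle.norm_coe] using μ.summable_norm)

theorem DiscreteMeasure.exists_fourier_add (μ ν : DiscreteMeasure (Dual Γ)) :
    ∃ ρ : DiscreteMeasure (Dual Γ), ∀ γ, ρ.fourier γ = μ.fourier γ + ν.fourier γ := by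
  refine ⟨⟨fun x => μ.mass x + ν.mass x, Summable.of_nonneg_of_le (fun _ => norm_nonneg _)
    (fun x => norm_add_le _ _) (μ.summable_norm.add ν.summable_norm)⟩, fun γ => ?_⟩
  simp only [DiscreteMeasure.fourier, mul_add]
  exact (μ.summable_fourier γ).tsum_add (ν.summable_fourier γ)

/-- Approximation with a relative error less than `1`, by combinations of two characters with
bounded coefficients, implies exact interpolation. -/
theorem isI0_range_of_approx {u : ℕ → Γ} {δ : ℝ} (hδ0 : 0 < δ) (hδ : δ < 1)
    (h : ∀ φ : ℕ → ℂ, (∀ n, ‖φ n‖ ≤ 1) → ∃ x y : Dual Γ, ∃ a b : ℂ, ‖a‖ ≤ 1 ∧ ‖b‖ ≤ 1 ∧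
      ∀ n, ‖φ n - (a * x (u n) + b * y (u n))‖ ≤ δ) :
    IsI0 (Set.range u) := by
  have h' : ∀ (r : ℕ → ℂ) (D : ℝ), ∃ x y : Dual Γ, ∃ a b : ℂ, 0 < D → (∀ n, ‖r n‖ ≤ D) →
      ‖a‖ ≤ D ∧ ‖b‖ ≤ D ∧ ∀ n, ‖r n - (a * x (u n) + b * y (u n))‖ ≤ D * δ := by
    intro r D
    by_cases hr : 0 < D ∧ ∀ n, ‖r n‖ ≤ D
    · obtain ⟨hD, hr⟩ := hr
      have hn : ‖(D : ℂ)‖ = D := by rw [Complex.norm_real, Real.norm_of_nonneg hD.le]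
      have hD' : (D : ℂ) ≠ 0 := by exact_mod_cast hD.ne'
      obtain ⟨x, y, a, b, ha, hb, hab⟩ := h (fun n => r n / D) fun n => by
        rw [norm_div, hn]; exact div_le_one_of_le₀ (hr n) hD.le
      refine ⟨x, y, D * a, D * b, fun _ _ => ⟨?_, ?_, fun n => ?_⟩⟩
      · rw [norm_mul, hn]; exact mul_le_of_le_one_right hD.le ha
      · rw [norm_mul, hn]; exact mul_le_of_le_one_right hD.le hb
      · have e : r n - (D * a * x (u n) + D * b * y (u n)) =
            D * (r n / D - (a * x (u n) + b * y (u n))) := by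
          field_simp
        rw [e, norm_mul, hn]
        exact mul_le_mul_of_nonneg_left (hab n) hD.le
    · exact ⟨1, 1, 0, 0, fun h1 h2 => absurd ⟨h1, h2⟩ hr⟩
  choose X Y A B hXY using h'
  intro φ ⟨C, hC⟩
  set D : ℝ := max C 1
  have hD : 0 < D := lt_max_of_lt_right one_pos
  let R : ℕ → ℕ → ℂ := fun k => Nat.rec (fun n => φ ⟨u n, n, rfl⟩) (fun k r n =>
    r n - (A r (D * δ ^ k) * X r (D * δ ^ k) (u n) + B r (D * δ ^ k) * Y r (D * δ ^ k) (u n))) k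
  have hR0 : ∀ n, R 0 n = φ ⟨u n, n, rfl⟩ := fun n => rfl
  have hRs : ∀ k n, R (k + 1) n = R k n - (A (R k) (D * δ ^ k) * X (R k) (D * δ ^ k) (u n) +
      B (R k) (D * δ ^ k) * Y (R k) (D * δ ^ k) (u n)) := fun k n => rfl
  have hpos : ∀ k, 0 < D * δ ^ k := fun k => by positivity
  have hR : ∀ k n, ‖R k n‖ ≤ D * δ ^ k := by
    intro k
    induction k with
    | zero => intro n; rw [hR0, pow_zero, mul_one]; exact (hC _).trans (le_max_left _ _)
    | succ k ih =>
      intro n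
      rw [hRs, pow_succ, ← mul_assoc]
      exact (hXY (R k) _ (hpos k) ih).2.2 n
  have hgeo : Summable fun k => D * δ ^ k := (summable_geometric_of_lt_one hδ0.le hδ).mul_left D
  set a : ℕ → ℂ := fun k => A (R k) (D * δ ^ k)
  set b : ℕ → ℂ := fun k => B (R k) (D * δ ^ k)
  set x : ℕ → Dual Γ := fun k => X (R k) (D * δ ^ k)
  set y : ℕ → Dual Γ := fun k => Y (R k) (D * δ ^ k)
  have ha : Summable fun k => ‖a k‖ := Summable.of_nonneg_of_le (fun _ => norm_nonneg _)
    (fun k => (hXY (R k) _ (hpos k) (hR k)).1) hgeo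
  have hb : Summable fun k => ‖b k‖ := Summable.of_nonneg_of_le (fun _ => norm_nonneg _)
    (fun k => (hXY (R k) _ (hpos k) (hR k)).2.1) hgeo
  obtain ⟨μ, hμ⟩ := exists_discreteMeasure_fourier_eq_tsum a ha x
  obtain ⟨ν, hν⟩ := exists_discreteMeasure_fourier_eq_tsum b hb y
  obtain ⟨ρ, hρ⟩ := μ.exists_fourier_add ν
  refine ⟨ρ, ?_⟩
  rintro ⟨_, n, rfl⟩
  have hsa : Summable fun k => a k * (x k (u n) : ℂ) :=
    Summable.of_norm (by simpa [norm_mul, Circle.norm_coe] using ha)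
  have hsb : Summable fun k => b k * (y k (u n) : ℂ) :=
    Summable.of_norm (by simpa [norm_mul, Circle.norm_coe] using hb)
  have hsum : ∀ N, ∑ k ∈ Finset.range N, (a k * x k (u n) + b k * y k (u n)) =
      φ ⟨u n, n, rfl⟩ - R N n := by
    intro N
    induction N with
    | zero => simp [hR0]
    | succ N ih =>
      rw [Finset.sum_range_succ, ih, hRs]
      ring
  have hlim : Filter.Tendsto (fun N => R N n) Filter.atTop (nhds 0) :=
    squeeze_zero_norm (fun N => hR N n) hgeo.tendsto_atTop_zero
  rw [hρ, hμ, hν, ← hsa.tsum_add hsb]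
  refine tendsto_nhds_unique (hsa.add hsb).hasSum.tendsto_sum_nat ?_
  simp only [hsum]
  simpa using tendsto_const_nhds.sub hlim

theorem isI0_range_of_kronecker {u : ℕ → Γ} {ε : ℝ} (hε : ε ≤ 1)
    (h : ∀ φ : ℕ → Circle, ∃ x : Dual Γ, ∀ i, ‖(x (u i) : ℂ) - φ i‖ ≤ ε) :
    IsI0 (Set.range u) := by
  refine isI0_range_of_approx (δ := 7 / 8) (by norm_num) (by norm_num) fun φ hφ => ?_
  obtain ⟨x, hx⟩ := h fun n => Circle.exp (φ n).arg
  refine ⟨x, 1, 1 / 2, 0, by norm_num, by norm_num, fun n => ?_⟩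
  have hx1 : ‖(x (u n) : ℂ) - Circle.exp (φ n).arg‖ ≤ 1 := (hx n).trans hε
  have hpol : φ n = (‖φ n‖ : ℂ) * (Circle.exp (φ n).arg : ℂ) := by
    rw [Circle.coe_exp, Complex.norm_mul_exp_arg_mul_I]
  set z : ℂ := (x (u n) : ℂ)
  set w : ℂ := (Circle.exp (φ n).arg : ℂ)
  set r : ℝ := ‖φ n‖
  have hr0 : 0 ≤ r := norm_nonneg _
  have hr1 : r ≤ 1 := hφ n
  have hz : ‖z‖ = 1 := Circle.norm_coe _
  have hw : ‖w‖ = 1 := Circle.norm_coe _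
  rw [hpol, zero_mul, add_zero]
  have e1 : ‖z - w‖ ^ 2 ≤ 1 := pow_le_one₀ (norm_nonneg _) hx1
  have e2 : ‖z‖ ^ 2 = 1 := by rw [hz, one_pow]
  have e3 : ‖w‖ ^ 2 = 1 := by rw [hw, one_pow]
  refine abs_le_of_sq_le_sq' (a := _) ?_ (by norm_num) |>.2
  rw [Complex.sq_norm, Complex.normSq_apply] at *
  simp only [Complex.sub_re, Complex.sub_im, Complex.mul_re, Complex.mul_im, Complex.ofReal_re,
    Complex.ofReal_im, zero_mul, sub_zero, add_zero] at *
  norm_num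
  nlinarith [mul_nonneg hr0 (sub_nonneg.2 hr1), mul_nonneg hr0 (sub_nonneg.2 e1)]

theorem isI0_range_of_signs {u : ℕ → Γ}
    (h : ∀ s : ℕ → ℂ, (∀ n, s n = 1 ∨ s n = -1) → ∃ x : Dual Γ, ∀ n, (x (u n) : ℂ) = s n) :
    IsI0 (Set.range u) := by
  refine isI0_range_of_approx (δ := 3 / 4) (by norm_num) (by norm_num) fun φ hφ => ?_
  have hs : ∀ f : ℕ → ℝ, (∀ n, |f n| ≤ 1) → ∃ x : Dual Γ, ∀ n, ∃ t : ℝ,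
      (x (u n) : ℂ) = t ∧ |f n - t / 2| ≤ 1 / 2 := by
    intro f hf
    obtain ⟨x, hx⟩ := h (fun n => if 0 ≤ f n then 1 else -1) fun n => by
      split_ifs <;> simp
    refine ⟨x, fun n => ⟨if 0 ≤ f n then 1 else -1, ?_, ?_⟩⟩
    · rw [hx]; split_ifs <;> simp
    · have := abs_le.1 (hf n)
      rw [abs_le]
      split_ifs with h0 <;> constructor <;> linarith
  obtain ⟨x, hx⟩ := hs (fun n => (φ n).re) fun n => (Complex.abs_re_le_norm _).trans (hφ n)
  obtain ⟨y, hy⟩ := hs (fun n => (φ n).im) fun n => (Complex.abs_im_le_norm _).trans (hφ n)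
  refine ⟨x, y, 1 / 2, Complex.I / 2, by norm_num, by simp; norm_num, fun n => ?_⟩
  obtain ⟨t, ht, ht'⟩ := hx n
  obtain ⟨v, hv, hv'⟩ := hy n
  rw [ht, hv]
  refine abs_le_of_sq_le_sq' (a := _) ?_ (by norm_num) |>.2
  have h1 := sq_le_sq' (abs_le.1 ht').1 (abs_le.1 ht').2
  have h2 := sq_le_sq' (abs_le.1 hv').1 (abs_le.1 hv').2
  rw [Complex.sq_norm, Complex.normSq_apply]
  have ere : (φ n - (1 / 2 * (t : ℂ) + Complex.I / 2 * v)).re = (φ n).re - t / 2 := by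
    simp; ring
  have eim : (φ n - (1 / 2 * (t : ℂ) + Complex.I / 2 * v)).im = (φ n).im - v / 2 := by
    simp; ring
  rw [ere, eim]
  nlinarith

/-! ### The pair of sets built from a sequence -/

theorem exists_seq_of_forall_finset {α : Type*} {F : Set α} {P : ℕ → Finset α → α → Prop}
    (h : ∀ n s, ∃ y ∈ F, P n s y) :
    ∃ l : ℕ → α, ∀ n, l n ∈ F ∧ ∃ s : Finset α, (∀ i < n, l i ∈ s) ∧ P n s (l n) := by
  classical
  choose c hcF hcP using h
  let T : ℕ → Finset α := fun n => Nat.rec ∅ (fun n s => insert (c n s) s) n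
  have hT : ∀ n, T (n + 1) = insert (c n (T n)) (T n) := fun n => rfl
  refine ⟨fun n => c n (T n), fun n => ⟨hcF _ _, T n, ?_, hcP _ _⟩⟩
  induction n with
  | zero => intro i hi; omega
  | succ n ih =>
    intro i hi
    rw [hT, Finset.mem_insert]
    rcases Nat.lt_succ_iff_lt_or_eq.1 hi with hi | rfl
    · exact Or.inr (ih i hi)
    · exact Or.inl rfl

/-- The small perturbations `l j - l (j + k + 1)`, enumerated by `(j, k) = unpair m`. -/
def shift (l : ℕ → Γ) (m : ℕ) : Γ :=
  l m.unpair.1 - l (m.unpair.1 + m.unpair.2 + 1)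

/-- The pigeonhole principle in the Bohr compactification. -/
theorem exists_norm_sub_lt (l : ℕ → Γ) (T : Finset (Dual Γ)) {η : ℝ} (hη : 0 < η) :
    ∃ m, ∀ x ∈ T, ‖(x (shift l m) : ℂ) - 1‖ < η := by
  obtain ⟨a, φ, hφ, hlim⟩ := CompactSpace.tendsto_subseq
    (fun n => fun x : T => (x : Dual Γ) (l n))
  have hc := hlim.cauchySeq
  obtain ⟨N, hN⟩ := Metric.cauchySeq_iff.1 hc η hη
  have hlt : φ N < φ (N + 1) := hφ (Nat.lt_succ_self N)
  refine ⟨Nat.pair (φ N) (φ (N + 1) - φ N - 1), fun x hx => ?_⟩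
  have h1 := (dist_pi_lt_iff hη).1 (hN N le_rfl (N + 1) (Nat.le_succ N)) ⟨x, hx⟩
  have e : φ N + (φ (N + 1) - φ N - 1) + 1 = φ (N + 1) := by omega
  rw [shift, Nat.unpair_pair]
  simp only [e]
  have h2 : ‖(x (l (φ N)) : ℂ) - x (l (φ (N + 1)))‖ < η := by
    rw [← dist_eq_norm]; exact h1
  have h3 : ((x (l (φ N) - l (φ (N + 1))) : ℂ) - 1) * x (l (φ (N + 1))) =
      (x (l (φ N)) : ℂ) - x (l (φ (N + 1))) := by
    rw [sub_mul, one_mul, ← Circle.coe_mul, ← AddChar.map_add_eq_mul, sub_add_cancel]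
  rwa [← h3, norm_mul, Circle.norm_coe, mul_one] at h2

theorem exists_norm_fourier_sub_lt (l : ℕ → Γ) (μ : DiscreteMeasure (Dual Γ)) :
    ∃ m, ∀ γ, ‖μ.fourier (γ + shift l m) - μ.fourier γ‖ < 1 := by
  classical
  set M := ∑' x, ‖μ.mass x‖
  have hM : 0 ≤ M := tsum_nonneg fun _ => norm_nonneg _
  obtain ⟨T, hT⟩ := (((tendsto_order.1 μ.summable_norm.hasSum).1 (M - 1 / 8)
    (by linarith))).exists
  obtain ⟨m, hm⟩ := exists_norm_sub_lt l T (η := 1 / (2 * (M + 1))) (by positivity)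
  refine ⟨m, fun γ => ?_⟩
  set d := shift l m
  let e : Dual Γ → ℝ := fun x => ‖(x d : ℂ) - 1‖ * ‖μ.mass x‖
  have he2 : ∀ x, e x ≤ 2 * ‖μ.mass x‖ := fun x => by
    refine mul_le_mul_of_nonneg_right ((norm_sub_le _ _).trans ?_) (norm_nonneg _)
    rw [Circle.norm_coe, norm_one]; norm_num
  have he0 : ∀ x, 0 ≤ e x := fun x => by positivity
  have hes : Summable e := Summable.of_nonneg_of_le he0 he2 (μ.summable_norm.mul_left 2)
  have hdiff : ∀ x : Dual Γ, ‖conj (x (γ + d) : ℂ) * μ.mass x - conj (x γ : ℂ) * μ.mass x‖ =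
      e x := by
    intro x
    have : conj (x (γ + d) : ℂ) * μ.mass x - conj (x γ : ℂ) * μ.mass x =
        conj (x γ : ℂ) * (conj ((x d : ℂ) - 1) * μ.mass x) := by
      rw [AddChar.map_add_eq_mul, Circle.coe_mul, map_mul, map_sub, map_one]
      ring
    rw [this, norm_mul, norm_mul, RCLike.norm_conj, RCLike.norm_conj, Circle.norm_coe, one_mul]
  have h1 : ‖μ.fourier (γ + d) - μ.fourier γ‖ ≤ ∑' x, e x := by
    rw [DiscreteMeasure.fourier, DiscreteMeasure.fourier,
      ← (μ.summable_fourier _).tsum_sub (μ.summable_fourier _)]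
    refine tsum_of_norm_bounded hes.hasSum fun x => (hdiff x).le
  have h2 : ∑ x ∈ T, e x ≤ 1 / 2 := by
    calc ∑ x ∈ T, e x ≤ ∑ x ∈ T, 1 / (2 * (M + 1)) * ‖μ.mass x‖ :=
          Finset.sum_le_sum fun x hx =>
            mul_le_mul_of_nonneg_right (hm x hx).le (norm_nonneg _)
      _ = 1 / (2 * (M + 1)) * ∑ x ∈ T, ‖μ.mass x‖ := (Finset.mul_sum _ _ _).symm
      _ ≤ 1 / (2 * (M + 1)) * (M + 1) := by
          gcongr
          have := μ.summable_norm.sum_le_tsum T fun _ _ => norm_nonneg _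
          linarith
      _ = 1 / 2 := by field_simp
  have h3 : ∑' x : ((T : Set (Dual Γ))ᶜ : Set (Dual Γ)), e x ≤ 1 / 4 := by
    calc ∑' x : ((T : Set (Dual Γ))ᶜ : Set (Dual Γ)), e x
        ≤ ∑' x : ((T : Set (Dual Γ))ᶜ : Set (Dual Γ)), 2 * ‖μ.mass x‖ :=
          (hes.subtype _).tsum_le_tsum (fun x => he2 x)
            ((μ.summable_norm.mul_left 2).subtype _)
      _ = 2 * ∑' x : ((T : Set (Dual Γ))ᶜ : Set (Dual Γ)), ‖μ.mass x‖ := tsum_mul_left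
      _ ≤ 1 / 4 := by
          have := μ.summable_norm.sum_add_tsum_compl (s := T)
          linarith
  have h4 := hes.sum_add_tsum_compl (s := T)
  linarith

/-- The sequences whose ranges form the pair: far terms of `l`, and their perturbations. -/
def far (l : ℕ → Γ) (m : ℕ) : Γ := l (m + 2)

theorem disjoint_range_far {l : ℕ → Γ}
    (hl : ∀ n, ∀ a < n, ∀ b < n, ∀ c < n, l n ≠ l a + l b - l c) :
    Disjoint (Set.range (far l)) (Set.range fun m => far l m + shift l m) := by
  rw [Set.disjoint_left]
  rintro _ ⟨p, rfl⟩ ⟨m, hm⟩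
  have hb := Nat.unpair_add_le m
  simp only [far, shift] at hm
  set j := m.unpair.1
  set k := m.unpair.2
  rcases lt_trichotomy p m with h | rfl | h
  · refine hl (m + 2) (p + 2) (by omega) (j + k + 1) (by omega) j (by omega) ?_
    rw [← hm]; abel
  · refine hl (j + k + 1) j (by omega) j (by omega) j (by omega) ?_
    have : l j - l (j + k + 1) = 0 := by simpa using hm
    rw [sub_eq_zero] at this
    rw [← this]; abel
  · refine hl (p + 2) (m + 2) (by omega) j (by omega) (j + k + 1) (by omega) ?_
    rw [← hm]; abel

theorem not_isI0_union_far {l : ℕ → Γ}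
    (hd : Disjoint (Set.range (far l)) (Set.range fun m => far l m + shift l m)) :
    ¬ IsI0 (Set.range (far l) ∪ Set.range fun m => far l m + shift l m) := by
  classical
  intro h
  obtain ⟨μ, hμ⟩ := h (fun γ => if (γ : Γ) ∈ Set.range (far l) then 0 else 1)
    ⟨1, fun γ => by split_ifs <;> simp⟩
  obtain ⟨m, hm⟩ := exists_norm_fourier_sub_lt l μ
  have h1 := hμ ⟨far l m, Or.inl ⟨m, rfl⟩⟩
  have h2 := hμ ⟨far l m + shift l m, Or.inr ⟨m, rfl⟩⟩
  rw [if_pos ⟨m, rfl⟩] at h1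
  rw [if_neg (fun h' => Set.disjoint_left.1 hd h' ⟨m, rfl⟩)] at h2
  have := hm (far l m)
  simp only at h1 h2
  rw [h1, h2] at this
  simp at this

theorem isGoodPair_far {F : Set Γ} {l : ℕ → Γ} {ε : ℝ} (hF : ∀ n, l n ∈ F)
    (hl : ∀ n, ∀ a < n, ∀ b < n, ∀ c < n, l n ≠ l a + l b - l c)
    (h : ∀ v : ℕ → Γ, v = far l ∨ v = (fun m => far l m + shift l m) →
      IsI0 (Set.range v) ∧ IsWeakKronecker ε (Set.range v)) :
    IsGoodPair F ε (Set.range (far l)) (Set.range fun m => far l m + shift l m) where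
  countable_left := Set.countable_range _
  countable_right := Set.countable_range _
  disjoint := disjoint_range_far hl
  subset_left := by rintro _ ⟨m, rfl⟩; exact hF _
  subset_right := by
    rintro _ ⟨m, rfl⟩
    dsimp only
    rw [shift, ← add_sub_assoc]
    exact Set.sub_mem_sub (Set.add_mem_add (hF _) (hF _)) (hF _)
  isI0_left := (h _ (Or.inl rfl)).1
  isI0_right := (h _ (Or.inr rfl)).1
  not_isI0_union := not_isI0_union_far (disjoint_range_far hl)
  kronecker_left := (h _ (Or.inl rfl)).2
  kronecker_right := (h _ (Or.inr rfl)).2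

theorem IsGoodPair.mono {F F' : Set Γ} {ε ε' : ℝ} {E E' : Set Γ} (h : IsGoodPair F ε E E')
    (hF : F ⊆ F') (hε : ε ≤ ε') : IsGoodPair F' ε' E E' where
  countable_left := h.countable_left
  countable_right := h.countable_right
  disjoint := h.disjoint
  subset_left := h.subset_left.trans hF
  subset_right := h.subset_right.trans (Set.sub_subset_sub (Set.add_subset_add hF hF) hF)
  isI0_left := h.isI0_left
  isI0_right := h.isI0_right
  not_isI0_union := h.not_isI0_union
  kronecker_left φ := (h.kronecker_left φ).imp fun _ hx γ => (hx γ).trans hε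
  kronecker_right φ := (h.kronecker_right φ).imp fun _ hx γ => (hx γ).trans hε

/-! ### Sequences of large order modulo their predecessors -/

/-- Modulo any finitely generated subgroup, some element of `F` has order at least `q`. -/
def Escapes (q : ℕ) (F : Set Γ) : Prop :=
  ∀ s : Finset Γ, ∃ γ ∈ F, ∀ m : ℕ, 0 < m → m < q → m • γ ∉ AddSubgroup.closure (s : Set Γ)

theorem Escapes.exists_seq {q : ℕ} {F : Set Γ} (hq : 2 ≤ q) (h : Escapes q F) (S : Finset Γ) :
    ∃ l : ℕ → Γ, (∀ n, l n ∈ F) ∧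
      (∀ n, ∀ a < n, ∀ b < n, ∀ c < n, l n ≠ l a + l b - l c) ∧
      ∀ v : ℕ → Γ, v = far l ∨ v = (fun m => far l m + shift l m) →
        ∀ φ : ℕ → Circle, ∃ x : Dual Γ, (∀ γ ∈ S, x γ = 1) ∧
          ∀ i, ‖(x (v i) : ℂ) - φ i‖ ≤ rootGap q := by
  classical
  obtain ⟨l, hl⟩ := exists_seq_of_forall_finset (F := F) (P := fun _ s y =>
    ∀ m : ℕ, 0 < m → m < q → m • y ∉ AddSubgroup.closure ((S ∪ s : Finset Γ) : Set Γ))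
    fun n s => h (S ∪ s)
  let H : ℕ → AddSubgroup Γ := fun n => AddSubgroup.closure (S ∪ l '' Set.Iio n)
  have hS : ∀ n, ∀ γ ∈ S, γ ∈ H n := fun n γ hγ => AddSubgroup.subset_closure (Or.inl hγ)
  have hmem : ∀ n, ∀ i < n, l i ∈ H n := fun n i hi =>
    AddSubgroup.subset_closure (Or.inr ⟨i, hi, rfl⟩)
  have hmono : Monotone H := fun a b hab =>
    AddSubgroup.closure_mono (Set.union_subset_union_right _
      (Set.image_mono (Set.Iio_subset_Iio hab)))
  have hord : ∀ n m, 0 < m → m < q → m • l n ∉ H n := by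
    intro n m hm hmq
    obtain ⟨-, s, hs, hP⟩ := hl n
    refine fun hc => hP m hm hmq (AddSubgroup.closure_mono ?_ hc)
    rw [Finset.coe_union]
    refine Set.union_subset_union_right _ ?_
    rintro _ ⟨i, hi, rfl⟩
    exact hs i hi
  refine ⟨l, fun n => (hl n).1, fun n a ha b hb c hc heq => ?_, fun v hv φ => ?_⟩
  · refine hord n 1 one_pos (by omega) ?_
    rw [one_smul, heq]
    exact sub_mem (add_mem (hmem n a ha) (hmem n b hb)) (hmem n c hc)
  · have hv' : ∀ m, ∃ d ∈ H (m + 2), v m = l (m + 2) + d := by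
      intro m
      rcases hv with rfl | rfl
      · exact ⟨0, zero_mem _, (add_zero _).symm⟩
      · have := Nat.unpair_add_le m
        exact ⟨shift l m, sub_mem (hmem _ _ (by omega)) (hmem _ _ (by omega)), rfl⟩
    obtain ⟨x, hx⟩ := exists_dual_of_step (S : Set Γ) v (ε := rootGap q) (η := 0) le_rfl
      (fun n x w => by
        obtain ⟨d, hd, hvd⟩ := hv' n
        obtain ⟨y, hy, hyH⟩ := exists_dual_near_of_subgroup (q := q) (by omega) (H (n + 2))
          (u := v n) (fun m hm hmq hc => hord (n + 2) m hm hmq (by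
            rw [hvd, smul_add] at hc
            exact (add_mem_cancel_right (nsmul_mem hd m)).1 hc)) x w
        refine ⟨y, hy, fun γ hγ => hyH γ (hS _ γ hγ), fun i hi => ?_⟩
        obtain ⟨d', hd', hvd'⟩ := hv' i
        rw [hyH, sub_self, norm_zero, zero_mul]
        rw [hvd']
        exact add_mem (hmem _ _ (by omega)) (hmono (by omega) hd')) φ
    exact ⟨x, by simpa using hx⟩

theorem Escapes.exists_isGoodPair {q : ℕ} {F : Set Γ} (hq : 3 ≤ q) (h : Escapes q F) :
    ∃ E E' : Set Γ, IsGoodPair F (rootGap q) E E' := by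
  obtain ⟨l, hlF, hl, hv⟩ := h.exists_seq (by omega) ∅
  refine ⟨_, _, isGoodPair_far hlF hl fun v hv' => ?_⟩
  have h' : ∀ φ : ℕ → Circle, ∃ x : Dual Γ, ∀ i, ‖(x (v i) : ℂ) - φ i‖ ≤ rootGap q :=
    fun φ => (hv v hv' φ).imp fun _ hx => hx.2
  exact ⟨isI0_range_of_kronecker (rootGap_le_one hq) h', isWeakKronecker_range h'⟩

/-- The case of elements of order two modulo a cyclic group. -/
theorem Escapes.exists_isGoodPair_of_two_nsmul_eq {F : Set Γ} (h : Escapes 2 F) {c : Γ}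
    (hc : ∀ γ ∈ F, 2 • γ = c) : ∃ E E' : Set Γ, IsGoodPair F √2 E E' := by
  obtain ⟨l, hlF, hl, hv⟩ := h.exists_seq le_rfl {c}
  rw [rootGap_two] at hv
  refine ⟨_, _, isGoodPair_far hlF hl fun v hv' => ⟨?_, ?_⟩⟩
  · have hvc : ∀ i, 2 • v i = c := by
      intro i
      rcases hv' with rfl | rfl
      · exact hc _ (hlF _)
      · simp only [far, shift, smul_add, smul_sub]
        rw [hc _ (hlF _), hc _ (hlF _), hc _ (hlF _)]
        abel
    refine isI0_range_of_signs fun s hs => ?_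
    have hs' : ∀ n, ∃ w : Circle, (w : ℂ) = s n := fun n => by
      rcases hs n with h1 | h1
      · exact ⟨1, by rw [h1, Circle.coe_one]⟩
      · exact ⟨⟨-1, by simp [Submonoid.unitSphere]⟩, by rw [h1]⟩
    choose w hw using hs'
    obtain ⟨x, hxc, hx⟩ := hv v hv' w
    refine ⟨x, fun n => ?_⟩
    have hsq : (x (v n) : ℂ) ^ 2 = 1 := by
      rw [← Circle.coe_pow, ← AddChar.map_nsmul_eq_pow, hvc, hxc c (Finset.mem_singleton_self c),
        Circle.coe_one]
    have hx' := hx n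
    rw [hw] at hx'
    rcases sq_eq_sq_iff_eq_or_eq_neg.1 (hsq.trans (one_pow 2).symm) with h1 | h1 <;>
      rcases hs n with h3 | h3 <;> rw [h1, h3] at hx' ⊢ <;> norm_num at hx'
  · exact isWeakKronecker_range fun φ => (hv v hv' φ).imp fun _ hx => hx.2

/-! ### Lacunary sequences -/

/-- The character `γ ↦ exp (i t g(γ))`. -/
noncomputable def expDual (g : Γ →+ ℝ) (t : ℝ) : Dual Γ where
  toFun γ := Circle.exp (t * g γ)
  map_zero_eq_one' := by simp
  map_add_eq_mul' a b := by rw [map_add, mul_add, Circle.exp_add]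

theorem norm_expDual_sub_one_le (g : Γ →+ ℝ) (t : ℝ) (γ : Γ) :
    ‖(expDual g t γ : ℂ) - 1‖ ≤ |t| * |g γ| := by
  have h := norm_exp_sub_exp (t * g γ) 0
  rw [Circle.exp_zero, Circle.coe_one, sub_zero] at h
  change ‖(Circle.exp (t * g γ) : ℂ) - 1‖ ≤ _
  rw [h, ← abs_mul]
  have : |Real.sin (t * g γ / 2)| ≤ |t * g γ / 2| := Real.abs_sin_le_abs
  rw [abs_div, abs_two] at this
  linarith

theorem exists_dual_eq_and_near (g : Γ →+ ℝ) {u : Γ} (hu : g u ≠ 0) (x : Dual Γ) (w : Circle) :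
    ∃ y : Dual Γ, y u = w ∧
      ∀ γ, ‖(y γ : ℂ) - x γ‖ ≤ Real.pi * |g γ| / |g u| := by
  set θ : ℝ := ((w * (x u)⁻¹ : Circle) : ℂ).arg
  refine ⟨x * expDual g (θ / g u), ?_, fun γ => ?_⟩
  · change x u * Circle.exp (θ / g u * g u) = w
    rw [div_mul_cancel₀ _ hu, Circle.exp_arg, mul_comm, inv_mul_cancel_right]
  · have e : (((x * expDual g (θ / g u)) γ : Circle) : ℂ) - x γ =
        x γ * ((expDual g (θ / g u) γ : ℂ) - 1) := by
      rw [AddChar.mul_apply, Circle.coe_mul]; ring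
    rw [e, norm_mul, Circle.norm_coe, one_mul]
    refine (norm_expDual_sub_one_le _ _ _).trans ?_
    rw [abs_div, div_mul_eq_mul_div]
    gcongr
    exact Complex.abs_arg_le_pi _

theorem UnboundedOn.exists_isGoodPair {F : Set Γ} {g : Γ →+ ℝ} (h : UnboundedOn g F) {ε : ℝ}
    (hε : 0 < ε) : ∃ E E' : Set Γ, IsGoodPair F ε E E' := by
  set η := min ε 1
  have hη : 0 < η := lt_min hε one_pos
  obtain ⟨l, hl⟩ := exists_seq_of_forall_finset (F := F) (P := fun n s y =>
    (4 + 2 ^ n * 10 / η) * (1 + ∑ z ∈ s, |g z|) < |g y|) fun n s => h _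
  have hB : ∀ n, ∃ B : ℝ, 0 ≤ B ∧ (∀ i < n, |g (l i)| ≤ B) ∧
      (4 + 2 ^ n * 10 / η) * (1 + B) < |g (l n)| := by
    intro n
    obtain ⟨-, s, hs, hP⟩ := hl n
    exact ⟨_, Finset.sum_nonneg fun _ _ => abs_nonneg _, fun i hi =>
      Finset.single_le_sum (f := fun z => |g z|) (fun _ _ => abs_nonneg _) (hs i hi), hP⟩
  refine ⟨_, _, (isGoodPair_far (ε := η) (fun n => (hl n).1) ?_ ?_).mono subset_rfl
    (min_le_left _ _)⟩
  · intro n a ha b hb c hc heq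
    obtain ⟨B, hB0, hB1, hB2⟩ := hB n
    have h1 : |g (l n)| ≤ 3 * B := by
      rw [heq, map_sub, map_add]
      have := abs_sub (g (l a) + g (l b)) (g (l c))
      have := abs_add_le (g (l a)) (g (l b))
      linarith [hB1 a ha, hB1 b hb, hB1 c hc]
    have h2 : 0 ≤ 2 ^ n * 10 / η * (1 + B) := by positivity
    linarith
  · intro v hv
    have hv' : ∀ m, ∃ d, v m = l (m + 2) + d ∧
        ∀ B, (∀ i < m + 2, |g (l i)| ≤ B) → 0 ≤ B → |g d| ≤ 2 * B := by
      intro m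
      rcases hv with rfl | rfl
      · exact ⟨0, (add_zero _).symm, fun B _ hB => by simpa using hB⟩
      · refine ⟨shift l m, rfl, fun B hB _ => ?_⟩
        have := Nat.unpair_add_le m
        rw [shift, map_sub]
        refine (abs_sub _ _).trans ?_
        have h1 := hB m.unpair.1 (by omega)
        have h2 := hB (m.unpair.1 + m.unpair.2 + 1) (by omega)
        linarith
    have key : ∀ φ : ℕ → Circle, ∃ x : Dual Γ, ∀ i, ‖(x (v i) : ℂ) - φ i‖ ≤ η := by
      intro φ
      obtain ⟨x, -, hx⟩ := exists_dual_of_step ∅ v (ε := 0) hη.le (fun n x w => by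
        obtain ⟨B, hB0, hB1, hB2⟩ := hB (n + 2)
        obtain ⟨d, hvd, hd⟩ := hv' n
        have h1 : |g (l (n + 2))| ≤ |g (v n)| + |g d| := by
          have : g (l (n + 2)) = g (v n) - g d := by rw [hvd, map_add]; ring
          rw [this]
          exact abs_sub _ _
        have h2 : 2 ^ (n + 2) * 10 / η * (1 + B) < |g (v n)| := by
          have := hd B hB1 hB0
          linarith
        have h3 : 0 < |g (v n)| := lt_of_le_of_lt (by positivity) h2
        obtain ⟨y, hy, hy'⟩ := exists_dual_eq_and_near g (abs_pos.1 h3) x w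
        refine ⟨y, by rw [hy, sub_self, norm_zero], fun _ h => absurd h (Set.notMem_empty _),
          fun i hi => (hy' _).trans ?_⟩
        obtain ⟨d', hvd', hd'⟩ := hv' i
        have h4 : |g (v i)| ≤ 3 * B := by
          have h5 := hd' B (fun j hj => hB1 j (by omega)) hB0
          have h6 := hB1 (i + 2) (by omega)
          rw [hvd', map_add]
          linarith [abs_add_le (g (l (i + 2))) (g d')]
        rw [div_le_iff₀ h3]
        have h7 : η * (1 / 2) ^ (n + 1) * (2 ^ (n + 2) * 10 / η * (1 + B)) = 20 * (1 + B) := by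
          have : (1 / 2 : ℝ) ^ (n + 1) * 2 ^ (n + 2) = 2 := by
            rw [pow_succ 2 (n + 1), ← mul_assoc, ← mul_pow]; norm_num
          calc η * (1 / 2) ^ (n + 1) * (2 ^ (n + 2) * 10 / η * (1 + B))
              = ((1 / 2) ^ (n + 1) * 2 ^ (n + 2)) * 10 * (1 + B) * (η / η) := by ring
            _ = 20 * (1 + B) := by rw [this, div_self hη.ne']; ring
        have h8 : η * (1 / 2) ^ (n + 1) * (2 ^ (n + 2) * 10 / η * (1 + B)) ≤
            η * (1 / 2) ^ (n + 1) * |g (v n)| :=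
          mul_le_mul_of_nonneg_left h2.le (by positivity)
        have h9 : Real.pi * |g (v i)| ≤ 4 * (3 * B) :=
          mul_le_mul Real.pi_le_four h4 (abs_nonneg _) (by norm_num)
        linarith) φ
      exact ⟨x, fun i => by simpa using hx i⟩
    exact ⟨isI0_range_of_kronecker (min_le_right _ _) key, isWeakKronecker_range key⟩

/-! ### The dichotomy between escaping and unbounded sets -/

theorem exists_unboundedOn_of_nsmul_mem {F : Set Γ} {N : ℕ} {s : Finset Γ}
    (hs : ∀ γ ∈ F, N • γ ∈ AddSubgroup.closure (s : Set Γ))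
    (hF : ((fun γ => N • γ) '' F).Infinite) : ∃ g : Γ →+ ℝ, UnboundedOn g F := by
  obtain ⟨h, hh⟩ := exists_hom_unbounded s (by rintro _ ⟨γ, hγ, rfl⟩; exact hs γ hγ) hF
  refine ⟨h.comp (nsmulAddMonoidHom N), fun B => ?_⟩
  obtain ⟨_, ⟨γ, hγ, rfl⟩, hB⟩ := hh B
  exact ⟨γ, hγ, hB⟩

/-- Either `F` contains elements of large order modulo any finitely generated subgroup, or some
real homomorphism is unbounded on `F`. -/
def IsSpread (F : Set Γ) : Prop := (∀ q, Escapes q F) ∨ ∃ g : Γ →+ ℝ, UnboundedOn g F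

theorem Escapes.of_image {A : Type*} [AddCommGroup A] (f : Γ →+ A) {q : ℕ} {F : Set Γ}
    (h : Escapes q (f '' F)) : Escapes q F := by
  classical
  intro s
  obtain ⟨_, ⟨γ, hγ, rfl⟩, hm⟩ := h (s.image f)
  refine ⟨γ, hγ, fun m h0 hq hc => hm m h0 hq ?_⟩
  rw [Finset.coe_image, ← AddMonoidHom.map_closure, ← map_nsmul]
  exact AddSubgroup.mem_map_of_mem f hc

theorem IsSpread.of_image {A : Type*} [AddCommGroup A] (f : Γ →+ A) {F : Set Γ}
    (h : IsSpread (f '' F)) : IsSpread F := by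
  rcases h with h | ⟨g, hg⟩
  · exact Or.inl fun q => (h q).of_image f
  · refine Or.inr ⟨g.comp f, fun B => ?_⟩
    obtain ⟨_, ⟨γ, hγ, rfl⟩, hB⟩ := hg B
    exact ⟨γ, hγ, hB⟩

theorem isSpread_of_finite_fibers {F : Set Γ} (hF : F.Infinite)
    (h : ∀ N : ℕ, N ≠ 0 → ∀ b : Γ, {a : Γ | N • a = b}.Finite) : IsSpread F := by
  rw [IsSpread, or_iff_not_imp_left]
  intro hq
  simp only [Escapes, not_forall, not_exists, not_and, not_not] at hq
  obtain ⟨q, s, hs⟩ := hq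
  refine exists_unboundedOn_of_nsmul_mem (N := q.factorial) (s := s) (fun γ hγ => ?_) fun hfin => ?_
  · obtain ⟨m, h0, hm, hmem⟩ := hs γ hγ
    obtain ⟨k, hk⟩ := Nat.dvd_factorial h0 hm.le
    rw [hk, mul_comm, mul_smul]
    exact nsmul_mem hmem k
  · exact hF (hfin.of_finite_fibers _ fun b _ =>
      (h _ q.factorial_ne_zero b).subset fun a ha => ha.2)

theorem IsSpread.exists_isGoodPair {F : Set Γ} (h : IsSpread F) {ε : ℝ} (hε : 0 < ε) :
    ∃ E E' : Set Γ, IsGoodPair F ε E E' := by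
  rcases h with h | ⟨g, hg⟩
  · obtain ⟨k, hk⟩ := exists_nat_gt (Real.pi / ε)
    obtain ⟨E, E', hE⟩ := (h (k + 3)).exists_isGoodPair (by omega)
    refine ⟨E, E', hE.mono subset_rfl ((rootGap_le (by omega)).trans ?_)⟩
    rw [div_lt_iff₀ hε] at hk
    rw [div_le_iff₀ (by positivity)]
    push_cast
    linarith
  · exact hg.exists_isGoodPair hε

theorem finite_nsmul_fiber_of_torsionFree (hΓ : IsAddTorsionFree Γ) {N : ℕ} (hN : N ≠ 0) (b : Γ) :
    {a : Γ | N • a = b}.Finite :=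
  Set.Subsingleton.finite fun a ha c hc =>
    hΓ.nsmul_right_injective hN ((show N • a = b from ha).trans (show N • c = b from hc).symm)

theorem finite_nsmul_fiber_of_isRatOrPrufer (hΓ : IsRatOrPrufer Γ) {N : ℕ} (hN : N ≠ 0) (b : Γ) :
    {a : Γ | N • a = b}.Finite := by
  rcases hΓ with ⟨⟨e⟩⟩ | ⟨p, -, ⟨e⟩⟩
  · refine Set.Subsingleton.finite fun a ha c hc => e.injective ?_
    have h : N • e a = N • e c := by
      rw [← map_nsmul, ← map_nsmul, show N • a = b from ha, show N • c = b from hc]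
    simpa [hN] using h
  · let f : Γ → ℂ := fun a => (((e a).toMul : primePowerRoots p) : Circle)
    have hf : Function.Injective f := fun a c h =>
      e.injective (Additive.toMul.injective (Subtype.ext (Circle.ext h)))
    refine Set.Finite.of_finite_image
      ((Polynomial.nthRoots N (f b)).toFinset.finite_toSet.subset ?_) hf.injOn
    rintro _ ⟨a, ha, rfl⟩
    have ha' : N • a = b := ha
    simp only [Finset.mem_coe, Multiset.mem_toFinset, Polynomial.mem_nthRoots (Nat.pos_of_ne_zero hN)]
    rw [← ha']
    simp [f]

theorem exists_isGoodPair_sqrt_two {F : Set Γ} (hF : F.Infinite) :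
    ∃ E E' : Set Γ, IsGoodPair F √2 E E' := by
  have h1 : (1 : ℝ) ≤ √2 := Real.one_le_sqrt.2 (by norm_num)
  by_cases h3 : Escapes 3 F
  · obtain ⟨E, E', h⟩ := h3.exists_isGoodPair le_rfl
    exact ⟨E, E', h.mono subset_rfl ((rootGap_le_one le_rfl).trans h1)⟩
  simp only [Escapes, not_forall, not_exists, not_and, not_not] at h3
  obtain ⟨s, hs⟩ := h3
  have hs2 : ∀ γ ∈ F, 2 • γ ∈ AddSubgroup.closure (s : Set Γ) := by
    intro γ hγ
    obtain ⟨m, h0, hm, hmem⟩ := hs γ hγ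
    interval_cases m
    · rw [one_smul] at hmem
      exact nsmul_mem hmem 2
    · exact hmem
  by_cases hfin : ((fun γ => 2 • γ) '' F).Finite
  · obtain ⟨c, -, hc⟩ : ∃ c ∈ (fun γ => 2 • γ) '' F, (F ∩ (fun γ => 2 • γ) ⁻¹' {c}).Infinite := by
      by_contra! hcon
      exact hF (hfin.of_finite_fibers _ hcon)
    have h2 : Escapes 2 (F ∩ (fun γ => 2 • γ) ⁻¹' {c}) := by
      by_contra h2
      simp only [Escapes, not_forall, not_exists, not_and, not_not] at h2
      obtain ⟨t, ht⟩ := h2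
      obtain ⟨h, hh⟩ := exists_hom_unbounded t (fun γ hγ => by
        obtain ⟨m, h0, hm, hmem⟩ := ht γ hγ
        obtain rfl : m = 1 := by omega
        rwa [one_smul] at hmem) hc
      obtain ⟨γ, hγ, hB⟩ := hh |h c|
      have : |h c| = 2 * |h γ| := by
        rw [← show 2 • γ = c from hγ.2, map_nsmul, nsmul_eq_mul, abs_mul]
        norm_num
      linarith [abs_nonneg (h γ)]
    obtain ⟨E, E', h⟩ := h2.exists_isGoodPair_of_two_nsmul_eq (c := c) fun γ hγ => hγ.2
    exact ⟨E, E', h.mono Set.inter_subset_left le_rfl⟩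
  · obtain ⟨g, hg⟩ := exists_unboundedOn_of_nsmul_mem hs2 hfin
    exact hg.exists_isGoodPair (by positivity)

theorem escapes_of_infinite_support {I : Type*} {Ω : I → Type*} [∀ α, AddCommGroup (Ω α)]
    (ι : Γ →+ ⨁ α, Ω α) {F : Set Γ} {q : ℕ}
    (h : {α | ∃ γ ∈ F, OrderAtLeast q (ι γ α)}.Infinite) : Escapes q F := by
  classical
  intro s
  obtain ⟨α, ⟨γ, hγ, ho⟩, hα⟩ := h.exists_notMem_finset (s.biUnion fun a => (ι a).support)
  let π : Γ →+ Ω α := (DFinsupp.evalAddMonoidHom α).comp ι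
  have hker : AddSubgroup.closure (s : Set Γ) ≤ π.ker := by
    rw [AddSubgroup.closure_le]
    intro a ha
    by_contra hne
    exact hα (Finset.mem_biUnion.2 ⟨a, ha, DFinsupp.mem_support_iff.2 hne⟩)
  refine ⟨γ, hγ, fun m h0 hm hmem => ?_⟩
  have hz : m • ι γ α = 0 := by
    have := hker hmem
    rw [AddMonoidHom.mem_ker, map_nsmul] at this
    exact this
  have hd := addOrderOf_dvd_of_nsmul_eq_zero hz
  rcases ho with ho | ho
  · rw [ho, zero_dvd_iff] at hd
    omega
  · exact absurd (Nat.le_of_dvd h0 hd) (by omega)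

end InterpolationSets

theorem theorem3p1 {Γ : Type*} [AddCommGroup Γ] (F : Set Γ) (hF : F.Infinite) :
    (∃ ε : ℝ, ε ≤ √2 ∧ ∃ E E' : Set Γ, IsGoodPair F ε E E') ∧
    (∀ (I : Type*) (Ω : I → Type*) [∀ α, AddCommGroup (Ω α)],
      (∀ α, IsRatOrPrufer (Ω α)) →
      ∀ ι : Γ →+ (⨁ α, Ω α), Function.Injective ι →
        ((∃ α, ((fun γ => ι γ α) '' F).Infinite) →
          ∀ ε : ℝ, 0 < ε → ∃ E E' : Set Γ, IsGoodPair F ε E E') ∧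
        (∀ q : ℕ, 2 ≤ q → {α | ∃ γ ∈ F, OrderAtLeast q (ι γ α)}.Infinite →
          ∃ E E' : Set Γ,
            IsGoodPair F ‖Complex.exp (Complex.I * Real.pi / q) - 1‖ E E')) ∧
    (IsAddTorsionFree Γ →
      ∀ ε : ℝ, 0 < ε → ∃ E E' : Set Γ, IsGoodPair F ε E E') := by
  refine ⟨⟨√2, le_rfl, exists_isGoodPair_sqrt_two hF⟩, ?_, ?_⟩
  · intro I Ω _ hΩ ι _
    refine ⟨?_, fun q hq h => ?_⟩
    · rintro ⟨α, hα⟩ ε hε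
      let π : Γ →+ Ω α := (DFinsupp.evalAddMonoidHom α).comp ι
      have hs : IsSpread (π '' F) := isSpread_of_finite_fibers hα fun N hN b =>
        finite_nsmul_fiber_of_isRatOrPrufer (hΩ α) hN b
      exact (hs.of_image π).exists_isGoodPair hε
    · change ∃ E E', IsGoodPair F (rootGap q) E E'
      rcases hq.eq_or_lt with rfl | hq
      · rw [rootGap_two]
        exact exists_isGoodPair_sqrt_two hF
      · exact (escapes_of_infinite_support ι h).exists_isGoodPair hq
  · intro hΓ ε hε
    exact (isSpread_of_finite_fibers hF fun N hN b =>
      finite_nsmul_fiber_of_torsionFree hΓ hN b).exists_isGoodPair hε
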